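/- Let $k$ be an algebraically closed field; all schemes are schemes of finite type over $k$, all morphisms are morphisms over $k$, and products are fibre products over $k$. Let $G$ be a connected group scheme, with neutral element $e_G \in G(k)$ and multiplication $\mu_G : G \times G \to G$, let $X$ be a scheme with a $G$-action $\alpha : G \times X \to X$, and let $Y$ be a scheme. Let $\pi : X \to Y$ be a proper morphism such that $\pi_*(\mathcal{O}_X) = \mathcal{O}_Y$, i.e., the canonical homomorphism of sheaves $\mathcal{O}_Y \to \pi_*(\mathcal{O}_X)$ is an isomorphism. Then there is a unique $G$-action on $Y$ such that $\pi$ is equivariant. That is, there is a unique morphism $\beta : G \times Y \to Y$ such that $\beta \circ (e_G \times \mathrm{id}_Y) = \mathrm{id}_Y$ (identifying $\operatorname{Spec}(k) \times Y$ with $Y$), $\beta \circ (\mathrm{id}_G \times \beta) = \beta \circ (\mu_G \times \mathrm{id}_Y)$, and $\beta \circ (\mathrm{id}_G \times \pi) = \pi \circ \alpha$. -/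

import Mathlib

universe u

open CategoryTheory AlgebraicGeometry

/-!
# Blanchard's lemma: group actions descend along fibrations

Write `p = id_G × π : G × X ⟶ G × Y` and `f = π ∘ α : G × X ⟶ Y`, where `α` is the action. Since
`G` is flat over the base field, `𝒪 ⟶ p_* 𝒪` is again an isomorphism, at least on a basis of open
sets (`isBasis_isIso_app_whiskerLeft`); together with surjectivity this makes `π`, `p` and
`id_G × p` epimorphisms of schemes (`epi_of_surjective_of_isSchemeTheoreticallyDominant`). Hence
everything reduces to factoring `f` through `p`: the factorization is unique, and it inherits the
axioms of an action from `α` (`existsUnique_modObj_of_whiskerLeft_comp_eq`).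

Factorizations may be constructed locally on `G × Y` and glued (`exists_comp_eq_of_forall_exists`),
and one exists near every point having a neighbourhood `U` such that `f` maps `p ⁻¹ U` into an
affine open of `Y`, because a morphism to an affine scheme is determined by global sections and
`p ⁻¹ U` has those of `U`. Let `Ω` be the open set of such points (`affineDescentLocus`). For a
rational point `g` of `G` and a point `y` of `Y`, the point `(g, y)` lies in `Ω` if and only if
`π ∘ g` is constant on the fibre `π ⁻¹ y` (`mem_affineDescentLocus_iff_translation`): one direction
is the local factorization, the other uses that `p` is closed. In particular `(e, y)` is in `Ω`.

It remains to see that `Ω` is everything, which is where connectedness of `G` enters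
(`sliceInclusion_underlyingPoint_mem_affineDescentLocus`). Let `y = π x` be a rational point, and
let `g` be a rational point in the closure of the open set `V` of those `h` with `(h, y) ∈ Ω`. The
morphism `h ↦ (g h⁻¹, π (h x))` sends `g` to `(e, π (g x)) ∈ Ω`, so there is a rational point
`h ∈ V` with `(g h⁻¹, π (h x)) ∈ Ω`. Then `h` maps the fibre over `y` into a single fibre, which is
in turn mapped into a single fibre by `g h⁻¹`; so `g = (g h⁻¹) h` belongs to `V`. Thus `V` is
open, closed, and contains `e`.
-/

/-! ### Actions in a cartesian monoidal category -/


namespace CategoryTheory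

open Limits MonoidalCategory CartesianMonoidalCategory
open scoped _root_.CategoryTheory.MonObj

variable {C : Type*} [Category* C] [CartesianMonoidalCategory C]

theorem isPullback_snd_whiskerLeft (G : C) {X Y : C} (π : X ⟶ Y) :
    IsPullback (snd G X) (G ◁ π) π (snd G Y) := by
  refine ⟨⟨by simp⟩, ⟨PullbackCone.IsLimit.mk _ (fun s ↦ lift (s.snd ≫ fst G Y) s.fst)
    (fun s ↦ by simp) (fun s ↦ ?_) fun s m h₁ h₂ ↦ ?_⟩⟩
  · ext1 <;> simp [s.condition]
  · ext1
    · simp [← h₂]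
    · simp [h₁]

/-- The inclusion `x ↦ (g, x)` of the slice of `G ⊗ X` at a global point `g` of `G`. -/
abbrev sliceInclusion {G : C} (g : 𝟙_ C ⟶ G) (X : C) : X ⟶ G ⊗ X := lift (toUnit X ≫ g) (𝟙 X)

theorem isPullback_sliceInclusion_whiskerLeft {G : C} (g : 𝟙_ C ⟶ G) {X Y : C} (π : X ⟶ Y) :
    IsPullback (sliceInclusion g X) π (G ◁ π) (sliceInclusion g Y) := by
  -- The composite of the inclusion of a slice with the second projection is the identity.
  refine .of_right (h₁₂ := snd G X) (h₂₂ := snd G Y) ?_ (by ext1 <;> simp)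
    (isPullback_snd_whiskerLeft G π)
  simpa using IsPullback.of_horiz_isIso ⟨by simp⟩

variable {G : C} [MonObj G]

/-- Translation by a global point `g` of a monoid object `G`, as an endomorphism of an object `X`
on which `G` acts. -/
abbrev translation (X : C) [ModObj G X] (g : 𝟙_ C ⟶ G) : X ⟶ X := (toUnit X ≫ g) • 𝟙 X

variable {X : C} [ModObj G X]

theorem translation_mul (g h : 𝟙_ C ⟶ G) :
    translation X (g * h) = translation X h ≫ translation X g := by
  simp [translation, ModObj.comp_smul, MonObj.comp_mul, mul_smul]

theorem translation_one : translation X (1 : 𝟙_ C ⟶ G) = 𝟙 X := by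
  simp [translation, MonObj.comp_one]

/-- A morphism `β` through which `(g, x) ↦ π (g • x)` factors is automatically an action, and the
only one for which `π` is equivariant, as soon as `π` and its products with `G` and `G ⊗ G` are
epimorphisms. -/
theorem existsUnique_modObj_of_whiskerLeft_comp_eq {Y : C} (π : X ⟶ Y) [Epi π] [Epi (G ◁ π)]
    [Epi (G ◁ G ◁ π)] (β : G ⊗ Y ⟶ Y) (hβ : G ◁ π ≫ β = γ[G, X] ≫ π) :
    ∃! _β : ModObj G Y, IsModHom G π := by
  let act : ModObj G Y :=
    { smul := β
      one_smul := by
        change η ▷ Y ≫ β = (λ_ Y).hom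
        have : Epi (𝟙_ C ◁ π) := by
          rw [id_whiskerLeft]
          infer_instance
        rw [← cancel_epi (𝟙_ C ◁ π), whisker_exchange_assoc, hβ, ModObj.one_smul_self_assoc,
          leftUnitor_naturality]
      mul_smul := by
        change μ ▷ Y ≫ β = (α_ G G Y).hom ≫ G ◁ β ≫ β
        have : Epi ((G ⊗ G) ◁ π) := by
          rw [tensor_whiskerLeft]
          infer_instance
        rw [← cancel_epi ((G ⊗ G) ◁ π), whisker_exchange_assoc, hβ, ModObj.mul_smul_self_assoc,
          tensor_whiskerLeft_assoc, Iso.inv_hom_id_assoc, ← whiskerLeft_comp_assoc, hβ,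
          whiskerLeft_comp_assoc, hβ] }
  refine ⟨act, ⟨hβ.symm⟩, fun act' h ↦ ModObj.ext _ _ ?_⟩
  rw [← cancel_epi (G ◁ π)]
  exact h.smul_hom.symm.trans hβ.symm

end CategoryTheory

namespace AlgebraicGeometry

open Limits MonoidalCategory CartesianMonoidalCategory MonObj

variable {A B Z : Scheme.{u}}

/-! ### Epimorphisms of schemes and factorizations -/

/-- The equalizer of two morphisms that agree after composition with `p` is an immersion. It is
surjective because `p` is, hence a closed immersion, and its ideal sheaf is contained in the kernel
of `p`, which vanishes. -/
theorem epi_of_surjective_of_isSchemeTheoreticallyDominant (p : A ⟶ B) [Surjective p]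
    [IsSchemeTheoreticallyDominant p] : Epi p where
  left_cancellation {Z} a b h := by
    let i := equalizer.ι a b
    have hp : equalizer.lift p h ≫ i = p := equalizer.lift_ι p h
    have hsurj : Function.Surjective i := fun y ↦ by
      obtain ⟨x, rfl⟩ := p.surjective y
      exact ⟨equalizer.lift p h x, by rw [← Scheme.Hom.comp_apply, hp]⟩
    have : IsClosedImmersion i :=
      .of_isPreimmersion i (by rw [hsurj.range_eq]; exact isClosed_univ)
    have hker : i.ker = ⊥ := le_bot_iff.mp <| by
      rw [← p.ker_eq_bot, ← hp]
      exact Scheme.Hom.le_ker_comp _ _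
    have : IsIso i := IsClosedImmersion.isIso_iff_ker_eq_bot.mpr hker
    rw [← cancel_epi i]
    exact equalizer.condition a b

theorem isSchemeTheoreticallyDominant_of_isIso_c (p : A ⟶ B) [QuasiCompact p] (hp : IsIso p.c) :
    IsSchemeTheoreticallyDominant p where
  ker_eq_bot := by
    have (U : B.Opens) : IsIso (p.app U) := inferInstanceAs (IsIso (p.c.app (.op U)))
    refine Scheme.IdealSheafData.ext (funext fun U ↦ ?_)
    rw [p.ker_apply, Scheme.IdealSheafData.ideal_bot, Pi.bot_apply,
      ← RingHom.injective_iff_ker_eq_bot]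
    exact (ConcreteCategory.bijective_of_isIso (p.app U)).1

/-- Flat base change for sections: if `𝒪_B ⟶ p_* 𝒪_A` is an isomorphism on an affine open `U`, then
so is its analogue for the base change of `p` along a flat morphism, on every affine open over `U`.
-/
theorem isIso_app_of_isPullback_of_flat {A' B' : Scheme.{u}} {q : A' ⟶ A} {p' : A' ⟶ B'}
    {p : A ⟶ B} {f : B' ⟶ B} (H : IsPullback q p' p f) [Flat f] [QuasiCompact p]
    [QuasiSeparated p] {U : B.Opens} {V : B'.Opens} (hU : IsAffineOpen U) (hV : IsAffineOpen V)
    (hVU : V ≤ f ⁻¹ᵁ U) [IsIso (p.app U)] : IsIso (p'.app V) := by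
  have hW : p' ⁻¹ᵁ V = q ⁻¹ᵁ (p ⁻¹ᵁ U) ⊓ p' ⁻¹ᵁ V := by
    rw [right_eq_inf, ← Scheme.Hom.comp_preimage, H.w, Scheme.Hom.comp_preimage]
    exact p'.preimage_mono hVU
  have h := (isIso_pushoutSection_iff H hVU le_rfl hW).mp <|
    isIso_pushoutSection_of_isQuasiSeparated_of_flat_right H hVU le_rfl hW hU hV
      (p.isCompact_preimage hU.isCompact) (p.isQuasiSeparated_preimage hU.isQuasiSeparated)
  rw [← Scheme.Hom.app_eq_appLE] at h
  rw [Scheme.Hom.app_eq_appLE]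
  exact h.isIso_inr_of_isIso

/-- If `p ⁻¹ U` and `U` have the same global sections and `f` maps `p ⁻¹ U` into an affine open,
then `f` factors through `p` over `U`. -/
theorem exists_comp_eq_of_isIso_app (p : A ⟶ B) (f : A ⟶ Z) {U : B.Opens} {W : Z.Opens}
    (hW : IsAffineOpen W) (hUW : p ⁻¹ᵁ U ≤ f ⁻¹ᵁ W) [IsIso (p.app U)] :
    ∃ h : U.toScheme ⟶ Z, p ∣_ U ≫ h = (p ⁻¹ᵁ U).ι ≫ f := by
  have : IsAffine W.toScheme := hW
  have : IsIso (p ∣_ U).appTop := by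
    have : IsIso (p.app (U.ι ''ᵁ ⊤)) := by rwa [U.ι_image_top]
    rw [morphismRestrict_appTop]
    exact IsIso.comp_isIso' this
      (A.presheaf.mapIso (eqToIso (image_morphismRestrict_preimage p U ⊤)).op).isIso_hom
  let f' := f.resLE W (p ⁻¹ᵁ U) hUW
  refine ⟨U.toScheme.toSpecΓ ≫ Spec.map (f'.appTop ≫ inv (p ∣_ U).appTop) ≫
    W.toScheme.isoSpec.inv ≫ W.ι, ?_⟩
  rw [Scheme.toSpecΓ_naturality_assoc, ← Spec.map_comp_assoc, Category.assoc, IsIso.inv_hom_id,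
    Category.comp_id, ← Scheme.toSpecΓ_naturality_assoc]
  simp [f']

theorem pullback_snd_comp_eq_of_morphismRestrict_comp_eq {p : A ⟶ B} {f : A ⟶ Z} {U : B.Opens}
    {h : U.toScheme ⟶ Z} (hf : p ∣_ U ≫ h = (p ⁻¹ᵁ U).ι ≫ f) {V : Scheme.{u}} {v : V ⟶ B}
    (w : V ⟶ U) (hw : w ≫ U.ι = v) : pullback.snd p v ≫ w ≫ h = pullback.fst p v ≫ f := by
  have e := isPullback_morphismRestrict p U
  have hw' : (pullback.snd p v ≫ w) ≫ U.ι = pullback.fst p v ≫ p := by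
    rw [Category.assoc, hw, pullback.condition]
  have : pullback.snd p v ≫ w = e.lift _ _ hw' ≫ p ∣_ U := (e.lift_fst _ _ _).symm
  rw [reassoc_of% this, hf]
  exact e.lift_snd_assoc _ _ _ _

/-- Local factorizations through `p` glue to a global one, since base changes of `p` to open
subschemes are epimorphisms. -/
theorem exists_comp_eq_of_forall_exists (p : A ⟶ B) [Surjective p] [QuasiCompact p]
    [IsSchemeTheoreticallyDominant p] (f : A ⟶ Z)
    (H : ∀ b : B, ∃ (U : B.Opens) (_ : b ∈ U) (h : U.toScheme ⟶ Z),
      p ∣_ U ≫ h = (p ⁻¹ᵁ U).ι ≫ f) : ∃ h : B ⟶ Z, p ≫ h = f := by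
  choose U hU h hf using H
  let 𝒰 : B.OpenCover := B.openCoverOfIsOpenCover U (by
    rw [TopologicalSpace.IsOpenCover, eq_top_iff]
    exact fun x _ ↦ TopologicalSpace.Opens.mem_iSup.mpr ⟨x, hU x⟩)
  have hglue (i j : B) :
      pullback.fst (𝒰.f i) (𝒰.f j) ≫ h i = pullback.snd (𝒰.f i) (𝒰.f j) ≫ h j := by
    let V := pullback (𝒰.f i) (𝒰.f j)
    let v : V ⟶ B := pullback.fst _ _ ≫ 𝒰.f i
    have (i : B) : IsOpenImmersion (𝒰.f i) := inferInstanceAs (IsOpenImmersion (U i).ι)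
    have : IsOpenImmersion v := inferInstanceAs (IsOpenImmersion (pullback.fst _ _ ≫ 𝒰.f i))
    have : Epi (pullback.snd p v) := epi_of_surjective_of_isSchemeTheoreticallyDominant _
    rw [← cancel_epi (pullback.snd p v)]
    exact (pullback_snd_comp_eq_of_morphismRestrict_comp_eq (hf i) _ rfl).trans
      (pullback_snd_comp_eq_of_morphismRestrict_comp_eq (hf j) _ pullback.condition.symm).symm
  refine ⟨𝒰.glueMorphisms h hglue, Scheme.Cover.hom_ext (𝒰.pullback₁ p) _ _ fun i ↦ ?_⟩
  refine Eq.trans ?_ (pullback_snd_comp_eq_of_morphismRestrict_comp_eq (hf i) (𝟙 _)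
    (Category.id_comp _))
  trans pullback.snd p (𝒰.f i) ≫ 𝒰.f i ≫ 𝒰.glueMorphisms h hglue
  · exact pullback.condition_assoc _
  · exact congr(pullback.snd p (𝒰.f i) ≫ $(𝒰.ι_glueMorphisms h hglue i))

/-! ### The locus where a morphism factors through an affine open -/

/-- For `p : A ⟶ B` and `f : A ⟶ Z`, the open set of points of `B` having a neighbourhood `U`
such that `f` maps `p ⁻¹ U` into an affine open of `Z`. -/
def affineDescentLocus (p : A ⟶ B) (f : A ⟶ Z) : B.Opens :=
  sSup {U | ∃ W : Z.Opens, IsAffineOpen W ∧ p ⁻¹ᵁ U ≤ f ⁻¹ᵁ W}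

theorem mem_affineDescentLocus {p : A ⟶ B} {f : A ⟶ Z} {b : B} :
    b ∈ affineDescentLocus p f ↔
      ∃ (U : B.Opens) (W : Z.Opens), IsAffineOpen W ∧ p ⁻¹ᵁ U ≤ f ⁻¹ᵁ W ∧ b ∈ U := by
  simp only [affineDescentLocus, TopologicalSpace.Opens.mem_sSup, Set.mem_ofPred_eq]
  tauto

/-- For closed `p`, it suffices that `f` is constant on the fibre: the complement of the image of
the complement of `f ⁻¹ W` is a suitable neighbourhood, for `W` an affine neighbourhood of `z`. -/
theorem mem_affineDescentLocus_of_fiber {p : A ⟶ B} [UniversallyClosed p] {f : A ⟶ Z} {b : B}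
    (z : Z) (h : ∀ a, p a = b → f a = z) : b ∈ affineDescentLocus p f := by
  obtain ⟨_, ⟨W, hW, rfl⟩, hz, -⟩ :=
    Z.isBasis_affineOpens.exists_subset_of_mem_open (Set.mem_univ z) isOpen_univ
  refine mem_affineDescentLocus.mpr ⟨⟨(p '' (f ⁻¹ᵁ W : Set A)ᶜ)ᶜ,
    (p.isClosedMap _ (f ⁻¹ᵁ W).isOpen.isClosed_compl).isOpen_compl⟩, W, hW, ?_, ?_⟩
  · intro a ha
    by_contra hna
    exact ha ⟨a, hna, rfl⟩
  · rintro ⟨a, hna, ha⟩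
    exact hna (by simpa [h a ha] using hz)

theorem exists_morphismRestrict_comp_eq_of_mem_affineDescentLocus {p : A ⟶ B} {f : A ⟶ Z}
    (hp : TopologicalSpace.Opens.IsBasis {U | IsIso (p.app U)}) {b : B}
    (hb : b ∈ affineDescentLocus p f) :
    ∃ (U : B.Opens) (_ : b ∈ U) (h : U.toScheme ⟶ Z), p ∣_ U ≫ h = (p ⁻¹ᵁ U).ι ≫ f := by
  obtain ⟨O, W, hW, hO, hbO⟩ := mem_affineDescentLocus.mp hb
  obtain ⟨U, _ : IsIso (p.app U), hbU, hUO⟩ :=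
    TopologicalSpace.Opens.isBasis_iff_nbhd.mp hp hbO
  exact ⟨U, hbU, exists_comp_eq_of_isIso_app p f hW ((p.preimage_mono hUO).trans hO)⟩

theorem apply_eq_of_mem_affineDescentLocus {p : A ⟶ B} {f : A ⟶ Z}
    (hp : TopologicalSpace.Opens.IsBasis {U | IsIso (p.app U)}) {a a' : A}
    (ha : p a ∈ affineDescentLocus p f) (h : p a = p a') : f a = f a' := by
  obtain ⟨U, hU, h', hh⟩ := exists_morphismRestrict_comp_eq_of_mem_affineDescentLocus hp ha
  obtain ⟨x, rfl⟩ : ∃ x : (p ⁻¹ᵁ U).toScheme, (p ⁻¹ᵁ U).ι x = a := ⟨⟨a, hU⟩, rfl⟩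
  obtain ⟨x', rfl⟩ : ∃ x' : (p ⁻¹ᵁ U).toScheme, (p ⁻¹ᵁ U).ι x' = a' :=
    ⟨⟨a', show p a' ∈ U from h ▸ hU⟩, rfl⟩
  have hx : (p ∣_ U) x = (p ∣_ U) x' := U.ι.isOpenEmbedding.injective <| by
    simpa only [← Scheme.Hom.comp_apply, morphismRestrict_ι] using h
  rw [← Scheme.Hom.comp_apply, ← Scheme.Hom.comp_apply, ← hh, Scheme.Hom.comp_apply, hx,
    Scheme.Hom.comp_apply]

/-! ### Translations and rational points -/

theorem isClosed_of_closure_inter_closedPoints_subset {T : Type*} [TopologicalSpace T]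
    [JacobsonSpace T] {V : Set T} (hV : IsOpen V) (h : closure V ∩ closedPoints T ⊆ V) :
    IsClosed V := by
  rw [← closure_subset_iff_isClosed, ← Set.sdiff_eq_empty, ← Set.not_nonempty_iff_eq_empty]
  intro hne
  obtain ⟨x, ⟨hx, hxV⟩, hxc⟩ := nonempty_inter_closedPoints hne
    (isClosed_closure.isLocallyClosed.inter hV.isClosed_compl.isLocallyClosed)
  exact hxV (h ⟨hx, hxc⟩)

theorem isPullback_left {S : Scheme.{u}} {W X Y Z : Over S} {a : W ⟶ X} {b : W ⟶ Y} {c : X ⟶ Z}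
    {d : Y ⟶ Z} (h : IsPullback a b c d) : IsPullback a.left b.left c.left d.left :=
  h.map (Over.forget S)

section
variable {S : Scheme.{u}} {G X Y : Over S} [MonObj G] [ModObj G X] {π : X ⟶ Y}

/-- The point `(g, y)` lies in the locus of `id_G × π` and `(g, x) ↦ π (g • x)` if and only if
translation by `g` maps the fibre of `π` over `y` into a single fibre. -/
theorem mem_affineDescentLocus_iff_translation [UniversallyClosed (G ◁ π).left] [Surjective π.left]
    (hp : TopologicalSpace.Opens.IsBasis {U | IsIso ((G ◁ π).left.app U)})
    (g : 𝟙_ (Over S) ⟶ G) (y : Y.left) :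
    (sliceInclusion g Y).left y ∈ affineDescentLocus (G ◁ π).left (γ[G, X] ≫ π).left ↔
      ∀ x x' : X.left, π.left x = y → π.left x' = y →
        (translation X g ≫ π).left x = (translation X g ≫ π).left x' := by
  have hsq := isPullback_sliceInclusion_whiskerLeft g π
  have hact (x : X.left) : (γ[G, X] ≫ π).left ((sliceInclusion g X).left x) =
      (translation X g ≫ π).left x := by
    rw [← Scheme.Hom.comp_apply, ← Over.comp_left, ← Category.assoc]
    rfl
  constructor
  · rintro hy x x' rfl hx'
    rw [← hact, ← hact]
    have hw (x : X.left) : (G ◁ π).left ((sliceInclusion g X).left x) =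
        (sliceInclusion g Y).left (π.left x) := by
      rw [← Scheme.Hom.comp_apply, ← Over.comp_left, hsq.w, Over.comp_left, Scheme.Hom.comp_apply]
    exact apply_eq_of_mem_affineDescentLocus hp (by rwa [hw]) (by rw [hw, hw, hx'])
  · intro H
    obtain ⟨x, rfl⟩ := π.left.surjective y
    refine mem_affineDescentLocus_of_fiber ((translation X g ≫ π).left x) fun a ha ↦ ?_
    obtain ⟨x', rfl, hx'⟩ := Scheme.exists_preimage_of_isPullback (isPullback_left hsq) a _ ha
    exact (hact x').trans (H x' x hx' rfl)

end

section
variable {k : Type u} [Field k]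

/-- The point of a scheme over `k` underlying a `k`-point. -/
noncomputable abbrev underlyingPoint {T : Over (Spec (CommRingCat.of k))} (t : 𝟙_ _ ⟶ T) :
    T.left :=
  t.left (IsLocalRing.closedPoint k)

theorem underlyingPoint_comp {T T' : Over (Spec (CommRingCat.of k))} (t : 𝟙_ _ ⟶ T)
    (φ : T ⟶ T') :
    underlyingPoint (t ≫ φ) = φ.left (underlyingPoint t) :=
  Scheme.Hom.comp_apply t.left φ.left _

variable [IsAlgClosed k]

theorem exists_underlyingPoint_eq {T : Over (Spec (CommRingCat.of k))} [LocallyOfFiniteType T.hom]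
    {z : T.left} (hz : IsClosed {z}) : ∃ t : 𝟙_ _ ⟶ T, underlyingPoint t = z :=
  ⟨Over.homMk (pointOfClosedPoint T.hom z hz) (pointOfClosedPoint_comp T.hom z hz),
    pointOfClosedPoint_apply T.hom z hz _⟩

theorem isClosed_underlyingPoint {T : Over (Spec (CommRingCat.of k))} [LocallyOfFiniteType T.hom]
    (t : 𝟙_ _ ⟶ T) : IsClosed {underlyingPoint t} :=
  (pointEquivClosedPoint T.hom ⟨t.left, by simp⟩).2

theorem exists_underlyingPoint_comp_eq {X Y : Over (Spec (CommRingCat.of k))}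
    [LocallyOfFiniteType X.hom] [LocallyOfFiniteType Y.hom] (π : X ⟶ Y) [Surjective π.left]
    (y : 𝟙_ _ ⟶ Y) :
    ∃ x : 𝟙_ _ ⟶ X, underlyingPoint (x ≫ π) = underlyingPoint y := by
  have : JacobsonSpace X.left := LocallyOfFiniteType.jacobsonSpace X.hom
  obtain ⟨x, hx⟩ := π.left.surjective (underlyingPoint y)
  obtain ⟨z, hz, hzc⟩ := nonempty_inter_closedPoints (Z := π.left ⁻¹' {underlyingPoint y}) ⟨x, hx⟩
    ((isClosed_underlyingPoint y).preimage π.left.continuous).isLocallyClosed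
  obtain ⟨t, rfl⟩ := exists_underlyingPoint_eq hzc
  exact ⟨t, (underlyingPoint_comp t π).trans hz⟩

/-- The key step: for `G` connected, translation by any rational point of `G` maps the fibre of `π`
over the image of a rational point into a single fibre. -/
theorem sliceInclusion_underlyingPoint_mem_affineDescentLocus
    {G X Y : Over (Spec (CommRingCat.of k))}
    [LocallyOfFiniteType G.hom] [LocallyOfFiniteType X.hom]
    [GrpObj G] [ConnectedSpace G.left] [ModObj G X]
    (π : X ⟶ Y) [UniversallyClosed (G ◁ π).left] [Surjective π.left]
    (hp : TopologicalSpace.Opens.IsBasis {U | IsIso ((G ◁ π).left.app U)})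
    (g : 𝟙_ _ ⟶ G) (x : 𝟙_ _ ⟶ X) :
    (sliceInclusion g Y).left (underlyingPoint (x ≫ π)) ∈
      affineDescentLocus (G ◁ π).left (γ[G, X] ≫ π).left := by
  have : JacobsonSpace G.left := LocallyOfFiniteType.jacobsonSpace G.hom
  let Ω := affineDescentLocus (G ◁ π).left (γ[G, X] ≫ π).left
  let ρ : G ⟶ G ⊗ Y := lift (𝟙 G) (toUnit G ≫ x ≫ π)
  have hρ (h : 𝟙_ _ ⟶ G) : ρ.left (underlyingPoint h) =
      (sliceInclusion h Y).left (underlyingPoint (x ≫ π)) := by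
    rw [← underlyingPoint_comp, ← underlyingPoint_comp]
    congr 1
    ext1 <;> simp [ρ]
  -- The rational points of `V` are those mapping the fibre over `π x` into a single fibre.
  let V : Set G.left := ρ.left ⁻¹ᵁ Ω
  have hV : IsOpen V := (ρ.left ⁻¹ᵁ Ω).isOpen
  have hVc : IsClosed V := by
    refine isClosed_of_closure_inter_closedPoints_subset hV ?_
    rintro _ ⟨hg, hgc⟩
    obtain ⟨g, rfl⟩ := exists_underlyingPoint_eq hgc
    -- `θ` is the morphism `h ↦ (g * h⁻¹, π (h • x))`.
    let θ : G ⟶ G ⊗ Y := lift ((toUnit G ≫ g) * (𝟙 G)⁻¹) ((𝟙 G • (toUnit G ≫ x)) ≫ π)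
    have hθ (h : 𝟙_ _ ⟶ G) : θ.left (underlyingPoint h) =
        (sliceInclusion (g * h⁻¹) Y).left (underlyingPoint ((x ≫ translation X h) ≫ π)) := by
      rw [← underlyingPoint_comp, ← underlyingPoint_comp]
      congr 1
      ext1
      · simp [θ, MonObj.comp_mul, GrpObj.comp_inv]
      · have : h ≫ (𝟙 G • (toUnit G ≫ x)) = x ≫ translation X h := by
          simp [ModObj.comp_smul]
        simp only [θ, comp_lift, lift_snd, Category.comp_id, ← reassoc_of% this, Category.assoc]
    have hθg : θ.left (underlyingPoint g) ∈ Ω := by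
      rw [hθ, mem_affineDescentLocus_iff_translation hp, mul_inv_cancel, translation_one]
      intro z z' hz hz'
      simp [hz, hz']
    obtain ⟨_, ⟨hhθ, hhV⟩, hhc⟩ := nonempty_inter_closedPoints
      (mem_closure_iff.mp hg _ (θ.left ⁻¹ᵁ Ω).isOpen hθg)
      ((θ.left ⁻¹ᵁ Ω).isOpen.inter hV).isLocallyClosed
    obtain ⟨h, rfl⟩ := exists_underlyingPoint_eq hhc
    have h₁ : ρ.left (underlyingPoint h) ∈ Ω := hhV
    have h₂ : θ.left (underlyingPoint h) ∈ Ω := hhθ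
    rw [hρ, mem_affineDescentLocus_iff_translation hp] at h₁
    rw [hθ, mem_affineDescentLocus_iff_translation hp] at h₂
    change ρ.left (underlyingPoint g) ∈ Ω
    rw [hρ, mem_affineDescentLocus_iff_translation hp]
    intro z z' hz hz'
    -- `h` maps the fibre over `π x` into that over `π (h • x)`, which `g * h⁻¹` maps into a fibre.
    have hgh : translation X g = translation X h ≫ translation X (g * h⁻¹) := by
      rw [← translation_mul, inv_mul_cancel_right]
    have hx : (translation X h ≫ π).left (underlyingPoint x) =
        underlyingPoint ((x ≫ translation X h) ≫ π) := by
      rw [← underlyingPoint_comp, Category.assoc]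
    rw [underlyingPoint_comp] at hz hz'
    rw [hgh, Category.assoc, Over.comp_left, Scheme.Hom.comp_apply, Scheme.Hom.comp_apply]
    apply h₂
    · rw [← hx, ← h₁ z _ (by rw [hz, underlyingPoint_comp]) (underlyingPoint_comp x π).symm,
        Over.comp_left, Scheme.Hom.comp_apply]
    · rw [← hx, ← h₁ z' _ (by rw [hz', underlyingPoint_comp]) (underlyingPoint_comp x π).symm,
        Over.comp_left, Scheme.Hom.comp_apply]
  have hone : underlyingPoint (1 : 𝟙_ _ ⟶ G) ∈ V := by
    change ρ.left _ ∈ Ω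
    rw [hρ, mem_affineDescentLocus_iff_translation hp, translation_one]
    intro z z' hz hz'
    simp [hz, hz']
  have hg : underlyingPoint g ∈ V :=
    IsClopen.eq_univ ⟨hVc, hV⟩ ⟨_, hone⟩ ▸ Set.mem_univ _
  rw [← hρ]
  exact hg
end

/-! ### Products with a scheme over a field -/

section
variable {k : Type u} [Field k] {X Y : Over (Spec (CommRingCat.of k))}

instance (G Y : Over (Spec (CommRingCat.of k))) : Flat (snd G Y).left :=
  have : Flat G.hom := inferInstanceAs (Flat (Y := Spec (CommRingCat.of k)) G.hom)
  inferInstanceAs (Flat (pullback.snd G.hom Y.hom))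

instance isProper_whiskerLeft (G : Over (Spec (CommRingCat.of k))) (π : X ⟶ Y) [IsProper π.left] :
    IsProper (G ◁ π).left :=
  MorphismProperty.of_isPullback (isPullback_left (isPullback_snd_whiskerLeft G π)) ‹_›

instance surjective_whiskerLeft (G : Over (Spec (CommRingCat.of k))) (π : X ⟶ Y)
    [Surjective π.left] : Surjective (G ◁ π).left :=
  MorphismProperty.of_isPullback (isPullback_left (isPullback_snd_whiskerLeft G π)) ‹_›

instance isSchemeTheoreticallyDominant_whiskerLeft (G : Over (Spec (CommRingCat.of k))) (π : X ⟶ Y)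
    [IsSchemeTheoreticallyDominant π.left] [QuasiCompact π.left] :
    IsSchemeTheoreticallyDominant (G ◁ π).left :=
  .of_isPullback (isPullback_left (isPullback_snd_whiskerLeft G π))

theorem isBasis_isIso_app_whiskerLeft (G : Over (Spec (CommRingCat.of k))) (π : X ⟶ Y)
    [QuasiCompact π.left] [QuasiSeparated π.left] (hπ : IsIso π.left.c) :
    TopologicalSpace.Opens.IsBasis {U | IsIso ((G ◁ π).left.app U)} := by
  refine TopologicalSpace.Opens.isBasis_iff_nbhd.mpr fun {O b} hb ↦ ?_
  obtain ⟨_, ⟨V, hV, rfl⟩, hbV, -⟩ := Y.left.isBasis_affineOpens.exists_subset_of_mem_open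
    (Set.mem_univ ((snd G Y).left b)) isOpen_univ
  obtain ⟨_, ⟨U, hU, rfl⟩, hbU, hUO⟩ := (G ⊗ Y).left.isBasis_affineOpens.exists_subset_of_mem_open
    (show b ∈ O ⊓ (snd G Y).left ⁻¹ᵁ V from ⟨hb, hbV⟩) (O ⊓ (snd G Y).left ⁻¹ᵁ V).isOpen
  have hUO' : U ≤ O ⊓ (snd G Y).left ⁻¹ᵁ V := hUO
  have : IsIso (π.left.app V) := inferInstanceAs (IsIso (π.left.c.app (.op V)))
  exact ⟨U, isIso_app_of_isPullback_of_flat (isPullback_left (isPullback_snd_whiskerLeft G π)) hV hU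
    (hUO'.trans inf_le_right), hbU, hUO'.trans inf_le_left⟩

/-- A proper morphism is closed, and injectivity of `𝒪_Y ⟶ π_* 𝒪_X` makes `π` dominant. -/
theorem surjective_of_isIso_c (π : X ⟶ Y) [IsProper π.left] (hπ : IsIso π.left.c) :
    Surjective π.left :=
  have := isSchemeTheoreticallyDominant_of_isIso_c π.left hπ
  inferInstance

end

/-! ### Descent of the action -/

theorem affineDescentLocus_eq_top {k : Type u} [Field k] [IsAlgClosed k]
    (G X Y : Over (Spec (CommRingCat.of k)))
    [LocallyOfFiniteType G.hom] [LocallyOfFiniteType X.hom] [LocallyOfFiniteType Y.hom]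
    [GrpObj G] [ConnectedSpace G.left] [ModObj G X]
    (π : X ⟶ Y) [IsProper π.left] (hπ : IsIso π.left.c) :
    affineDescentLocus (G ◁ π).left (γ[G, X] ≫ π).left = ⊤ := by
  have := surjective_of_isIso_c π hπ
  have : LocallyOfFiniteType (G ⊗ Y).hom := by dsimp; infer_instance
  have : JacobsonSpace (G ⊗ Y).left := LocallyOfFiniteType.jacobsonSpace (G ⊗ Y).hom
  by_contra hne
  obtain ⟨b, hb, hbc⟩ := nonempty_inter_closedPoints
    (Z := (affineDescentLocus (G ◁ π).left (γ[G, X] ≫ π).left : Set (G ⊗ Y).left)ᶜ)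
    (Set.nonempty_compl.mpr (by simpa using hne))
    (affineDescentLocus _ _).isOpen.isClosed_compl.isLocallyClosed
  obtain ⟨t, rfl⟩ := exists_underlyingPoint_eq hbc
  obtain ⟨x, hx⟩ := exists_underlyingPoint_comp_eq π (t ≫ snd G Y)
  have := sliceInclusion_underlyingPoint_mem_affineDescentLocus π
    (isBasis_isIso_app_whiskerLeft G π hπ) (t ≫ fst G Y) x
  rw [hx, ← underlyingPoint_comp] at this
  have ht : (t ≫ snd G Y) ≫ sliceInclusion (t ≫ fst G Y) Y = t := by ext1 <;> simp
  rw [ht] at this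
  exact hb this

theorem exists_whiskerLeft_comp_eq {k : Type u} [Field k] [IsAlgClosed k]
    (G X Y : Over (Spec (CommRingCat.of k)))
    [LocallyOfFiniteType G.hom] [LocallyOfFiniteType X.hom] [LocallyOfFiniteType Y.hom]
    [GrpObj G] [ConnectedSpace G.left] [ModObj G X]
    (π : X ⟶ Y) [IsProper π.left] (hπ : IsIso π.left.c) :
    ∃ β : G ⊗ Y ⟶ Y, G ◁ π ≫ β = γ[G, X] ≫ π := by
  have := surjective_of_isIso_c π hπ
  have := isSchemeTheoreticallyDominant_of_isIso_c π.left hπ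
  have : Epi (G ◁ π).left := epi_of_surjective_of_isSchemeTheoreticallyDominant _
  obtain ⟨h, hh⟩ := exists_comp_eq_of_forall_exists (G ◁ π).left (γ[G, X] ≫ π).left fun b ↦
    exists_morphismRestrict_comp_eq_of_mem_affineDescentLocus (isBasis_isIso_app_whiskerLeft G π hπ)
      (affineDescentLocus_eq_top G X Y π hπ ▸ TopologicalSpace.Opens.mem_top b)
  have hw : h ≫ Y.hom = (G ⊗ Y).hom := by
    rw [← cancel_epi (G ◁ π).left, reassoc_of% hh, Over.w, Over.w]
    rfl
  exact ⟨Over.homMk h hw, by ext1; exact hh⟩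

end AlgebraicGeometry

theorem proposition2p1 {k : Type u} [Field k] [IsAlgClosed k]
    (G X Y : Over (Spec (CommRingCat.of k)))
    [LocallyOfFiniteType G.hom] [QuasiCompact G.hom]
    [LocallyOfFiniteType X.hom] [QuasiCompact X.hom]
    [LocallyOfFiniteType Y.hom] [QuasiCompact Y.hom]
    [GrpObj G] [ConnectedSpace G.left] [ModObj G X]
    (π : X ⟶ Y) [IsProper π.left] (hπ : IsIso π.left.c) :
    ∃! _β : ModObj G Y, IsModHom G π := by
  have := surjective_of_isIso_c π hπ
  have := isSchemeTheoreticallyDominant_of_isIso_c π.left hπ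
  have epi {A B : Over (Spec (CommRingCat.of k))} (φ : A ⟶ B) [Surjective φ.left]
      [IsSchemeTheoreticallyDominant φ.left] : Epi φ :=
    have := epi_of_surjective_of_isSchemeTheoreticallyDominant φ.left
    Over.epi_of_epi_left φ
  have := epi π
  open MonoidalCategory in have := epi (G ◁ π)
  open MonoidalCategory in have := epi (G ◁ G ◁ π)
  obtain ⟨β, hβ⟩ := exists_whiskerLeft_comp_eq G X Y π hπ
  exact existsUnique_modObj_of_whiskerLeft_comp_eq π β hβ
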